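/- Let $\mathfrak{c}=2^{\aleph_0}$. For $A,B\subseteq\omega$ write $A\subseteq^* B$ if $A\setminus B$ is finite, and $A\subsetneq^* B$ if $A\subseteq^* B$ and $B\setminus A$ is infinite. Let $\mathfrak{p}$ be the least cardinality of a family $\mathcal{B}$ of infinite subsets of $\omega$ such that every nonempty finite subfamily of $\mathcal{B}$ has infinite intersection, but there is no infinite $A\subseteq\omega$ with $A\subseteq^* B$ for all $B\in\mathcal{B}$. A separable metrizable space $X$ is called a $\sigma$-set if every $F_\sigma$-subset of $X$ is a $G_\delta$-set in $X$, and a $Q$-set if every subset of $X$ is a $G_\delta$-set in $X$. Let $[\omega]^\omega$ be the set of all infinite subsets of $\omega$, regarded, by identifying sets with their characteristic functions, as a subspace of the Cantor cube $2^\omega$. Assume $\mathfrak{p}=\mathfrak{c}$. Then there exists a subspace $X\subseteq[\omega]^\omega$ which is a $\sigma$-set with $|X|=\mathfrak{c}$, and which is therefore not a $Q$-set. Moreover, $X$ can be chosen of the form $X=\{M_\alpha:\alpha<\mathfrak{c}\}$ with $M_\alpha\subsetneq^* M_\beta$ for all $\beta<\alpha<\mathfrak{c}$. -/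

import Mathlib

open Cardinal

/-- `A ⊆* B`: the difference `A \ B` is finite. -/
def AlmostSubset (A B : Set ℕ) : Prop :=
  (A \ B).Finite

/-- `A ⊊* B`: `A ⊆* B` and `B \ A` is infinite. -/
def StrictAlmostSubset (A B : Set ℕ) : Prop :=
  AlmostSubset A B ∧ (B \ A).Infinite

/-- The strong finite intersection property: every nonempty finite subfamily has infinite
intersection. -/
def HasSFIP (𝓑 : Set (Set ℕ)) : Prop :=
  ∀ 𝓕 : Set (Set ℕ), 𝓕 ⊆ 𝓑 → 𝓕.Finite → 𝓕.Nonempty → (⋂₀ 𝓕).Infinite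

/-- The pseudointersection number `𝔭`: the least cardinality of a family of infinite subsets of `ℕ`
with the strong finite intersection property and without an infinite pseudointersection. -/
noncomputable def pseudointersectionNumber : Cardinal.{0} :=
  sInf {κ : Cardinal.{0} | ∃ 𝓑 : Set (Set ℕ), #𝓑 = κ ∧ (∀ B ∈ 𝓑, B.Infinite) ∧ HasSFIP 𝓑 ∧
    ¬ ∃ A : Set ℕ, A.Infinite ∧ ∀ B ∈ 𝓑, AlmostSubset A B}

/-- An `F_σ`-set: a countable union of closed sets. -/
def IsFSigma {X : Type*} [TopologicalSpace X] (s : Set X) : Prop :=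
  ∃ F : ℕ → Set X, (∀ n, IsClosed (F n)) ∧ s = ⋃ n, F n

/-- A `σ`-set: a separable metrizable space in which every `F_σ`-subset is a `G_δ`-set. -/
def IsSigmaSet (X : Type*) [TopologicalSpace X] : Prop :=
  TopologicalSpace.SeparableSpace X ∧ TopologicalSpace.MetrizableSpace X ∧
    ∀ s : Set X, IsFSigma s → IsGδ s

/-- A `Q`-set: a separable metrizable space in which every subset is a `G_δ`-set. -/
def IsQSet (X : Type*) [TopologicalSpace X] : Prop :=
  TopologicalSpace.SeparableSpace X ∧ TopologicalSpace.MetrizableSpace X ∧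
    ∀ s : Set X, IsGδ s

/-- The set `[ω]^ω` of all infinite subsets of `ℕ`. -/
def InfiniteSubsets : Type :=
  {A : Set ℕ // A.Infinite}

open Classical in
/-- The characteristic function of an infinite set, a point of the Cantor cube `ℕ → Bool`. -/
noncomputable def InfiniteSubsets.charFun (A : InfiniteSubsets) : ℕ → Bool :=
  fun n => decide (n ∈ A.1)

/-- `[ω]^ω` carries the subspace topology of the Cantor cube with its product topology. -/
noncomputable instance : TopologicalSpace InfiniteSubsets :=
  TopologicalSpace.induced InfiniteSubsets.charFun inferInstance

/-! Enumerate the Borel subsets of the Cantor cube as `W α`, α < 𝔠, and build the tower by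
recursion. By `exists_tower_extension`, `M α` can be chosen below its predecessors so that `W α`
agrees with a G_δ-set on {A : A ⊆* `M α`}, and some G_δ-set contains all these A but no earlier `M
β`. An F_σ-subset of X is the trace of some `W α`. Its part in the tail from α on is then G_δ. The
earlier points are those not almost contained in `M α`, a G_δ condition, and being fewer than 𝔭 they
form a Q-set (`exists_isGδ_forall_mem_iff`).

The first demand on `M α` is met by Ramsey theory: Borel families are completely Ramsey
(Galvin–Prikry), and fusion turns this into a G_δ description. For the second, fewer than 𝔭 sets all
meet almost all intervals of some infinite family, while the new set skips infinitely many of them.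
Finally, X has at most 𝔠 Borel subsets but 2^𝔠 subsets, so it is not a Q-set. -/

/-! ### Fusion. -/

/-- A property of sets of naturals that passes to subsets and holds for some infinite subset of
every infinite set. -/
structure DenseHereditary (D : Set ℕ → Prop) : Prop where
  mono : ∀ ⦃Q Q' : Set ℕ⦄, Q' ⊆ Q → D Q → D Q'
  exists_subset : ∀ P : Set ℕ, P.Infinite → ∃ Q ⊆ P, Q.Infinite ∧ D Q

namespace DenseHereditary

theorem and {D E : Set ℕ → Prop} (hD : DenseHereditary D) (hE : DenseHereditary E) :
    DenseHereditary fun Q => D Q ∧ E Q where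
  mono Q Q' h hQ := ⟨hD.mono h hQ.1, hE.mono h hQ.2⟩
  exists_subset P hP := by
    obtain ⟨Q, hQP, hQ, hDQ⟩ := hD.exists_subset P hP
    obtain ⟨R, hRQ, hR, hER⟩ := hE.exists_subset Q hQ
    exact ⟨R, hRQ.trans hQP, hR, hD.mono hRQ hDQ, hER⟩

theorem forall_mem {ι : Type*} {t : Set ι} (ht : t.Finite) {D : ι → Set ℕ → Prop}
    (hD : ∀ i ∈ t, DenseHereditary (D i)) : DenseHereditary fun Q => ∀ i ∈ t, D i Q := by
  induction t, ht using Set.Finite.induction_on with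
  | empty => exact ⟨by simp, fun P hP => ⟨P, subset_rfl, hP, by simp⟩⟩
  | insert _ _ ih =>
    simp only [Set.forall_mem_insert] at hD ⊢
    exact hD.1.and (ih hD.2)

/-- Fusion: countably many dense hereditary properties, diagonalized. -/
theorem fusion {D : ℕ → Set ℕ → Prop} (hD : ∀ k, DenseHereditary (D k)) {P : Set ℕ}
    (hP : P.Infinite) : ∃ M ⊆ P, M.Infinite ∧ ∀ k ∈ M, D k (M \ Set.Iic k) := by
  -- The minimum of the current set becomes the next element of `M`, and the rest is thinned for the
  -- property indexed by it.
  have step : ∀ Q : {Q : Set ℕ // Q.Infinite}, ∃ R : {R : Set ℕ // R.Infinite},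
      R.1 ⊆ Q.1 \ Set.Iic (sInf Q.1) ∧ D (sInf Q.1) R.1 := fun Q => by
    obtain ⟨R, h, hR, hDR⟩ := (hD (sInf Q.1)).exists_subset _ (Q.2.sdiff (Set.finite_Iic (sInf Q.1)))
    exact ⟨⟨R, hR⟩, h, hDR⟩
  choose next hnext hDnext using step
  let q : ℕ → {Q : Set ℕ // Q.Infinite} := fun n => next^[n] ⟨P, hP⟩
  have hq : ∀ n, q (n + 1) = next (q n) := fun n => Function.iterate_succ_apply' _ _ _
  let m : ℕ → ℕ := fun n => sInf (q n).1
  have hm : ∀ n, m n ∈ (q n).1 := fun n => Nat.sInf_mem (q n).2.nonempty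
  have hsub : ∀ n, (q (n + 1)).1 ⊆ (q n).1 \ Set.Iic (m n) := fun n => by
    rw [hq]; exact hnext _
  have hanti : Antitone fun n => (q n).1 :=
    antitone_nat_of_succ_le fun n => (hsub n).trans Set.sdiff_subset
  have hmono : StrictMono m := strictMono_nat_of_lt_succ fun n => by
    simpa using (hsub n (hm (n + 1))).2
  refine ⟨Set.range m, ?_, Set.infinite_range_of_injective hmono.injective, ?_⟩
  · rintro _ ⟨n, rfl⟩
    exact hanti (Nat.zero_le n) (hm n)
  · rintro _ ⟨n, rfl⟩
    have h : D (m n) (q (n + 1)).1 := by rw [hq]; exact hDnext _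
    refine (hD _).mono ?_ h
    rintro _ ⟨⟨j, rfl⟩, hj⟩
    have hj : n < j := hmono.lt_iff_lt.1 (by simpa using hj)
    exact hanti (Nat.succ_le_of_lt hj) (hm j)

end DenseHereditary

/-! ### Completely Ramsey families and the Galvin–Prikry theorem. -/

/-- All sets `s ∪ A` with `A` an infinite subset of `Q` belong to `U`. -/
def Accepts (U : Set (Set ℕ)) (s Q : Set ℕ) : Prop :=
  ∀ A ⊆ Q, A.Infinite → s ∪ A ∈ U

theorem Accepts.mono {U : Set (Set ℕ)} {s Q Q' : Set ℕ} (h : Q' ⊆ Q) (hQ : Accepts U s Q) :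
    Accepts U s Q' :=
  fun A hA => hQ A (hA.trans h)

/-- Either all sets `s ∪ A` with `A` an infinite subset of `Q` belong to `U`, or none does. -/
def Homogeneous (U : Set (Set ℕ)) (s Q : Set ℕ) : Prop :=
  Accepts U s Q ∨ Accepts Uᶜ s Q

/-- A completely Ramsey family of sets. -/
def CompletelyRamsey (U : Set (Set ℕ)) : Prop :=
  ∀ s : Set ℕ, s.Finite → DenseHereditary (Homogeneous U s)

theorem Homogeneous.mono {U : Set (Set ℕ)} {s Q Q' : Set ℕ} (h : Q' ⊆ Q)
    (hQ : Homogeneous U s Q) : Homogeneous U s Q' :=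
  hQ.imp (Accepts.mono h) (Accepts.mono h)

theorem CompletelyRamsey.of_exists {U : Set (Set ℕ)}
    (h : ∀ s : Set ℕ, s.Finite → ∀ P : Set ℕ, P.Infinite →
      ∃ Q ⊆ P, Q.Infinite ∧ Homogeneous U s Q) : CompletelyRamsey U :=
  fun s hs => ⟨fun _ _ => Homogeneous.mono, h s hs⟩

theorem CompletelyRamsey.compl {U : Set (Set ℕ)} (h : CompletelyRamsey U) :
    CompletelyRamsey Uᶜ := by
  refine .of_exists fun s hs P hP => ?_
  obtain ⟨Q, hQP, hQ, hU⟩ := (h s hs).exists_subset P hP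
  exact ⟨Q, hQP, hQ, by rw [Homogeneous, compl_compl]; exact hU.symm⟩

theorem denseHereditary_accepts_or_rejects (U : Set (Set ℕ)) (s : Set ℕ) :
    DenseHereditary fun Q =>
      Accepts U s Q ∨ ∀ Q' ⊆ Q, Q'.Infinite → ¬ Accepts U s Q' where
  mono Q Q' h hQ := hQ.imp (Accepts.mono h) fun hr R hR => hr R (hR.trans h)
  exists_subset P hP := by
    by_cases h : ∃ Q ⊆ P, Q.Infinite ∧ Accepts U s Q
    · obtain ⟨Q, hQP, hQ, ha⟩ := h
      exact ⟨Q, hQP, hQ, .inl ha⟩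
    · exact ⟨P, subset_rfl, hP, .inr fun Q hQP hQ ha => h ⟨Q, hQP, hQ, ha⟩⟩

/-- Countable unions of completely Ramsey families are completely Ramsey. -/
theorem CompletelyRamsey.iUnion {V : ℕ → Set (Set ℕ)} (hV : ∀ n, CompletelyRamsey (V n)) :
    CompletelyRamsey (⋃ n, V n) := by
  refine .of_exists fun s₀ hs₀ P hP => ?_
  set U := ⋃ n, V n with hU
  obtain ⟨k₀, hk₀⟩ := hs₀.bddAbove
  have hfin : ∀ k : ℕ, (𝒫 (Set.Iic k)).Finite := fun k => (Set.finite_Iic k).finite_subsets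
  obtain ⟨M, hMP, hM, hMD⟩ := DenseHereditary.fusion (D := fun k Q => ∀ s ∈ 𝒫 (Set.Iic k),
      (Accepts U s Q ∨ ∀ Q' ⊆ Q, Q'.Infinite → ¬ Accepts U s Q') ∧
        ∀ n ∈ Set.Iic k, Homogeneous (V n) s Q)
    (fun k => .forall_mem (hfin k) fun s hs => (denseHereditary_accepts_or_rejects U s).and
      (.forall_mem (Set.finite_Iic k) fun n _ => hV n s ((Set.finite_Iic k).subset hs)))
    (hP.sdiff (Set.finite_Iic k₀))
  by_cases hacc : ∃ Q ⊆ M, Q.Infinite ∧ Accepts U s₀ Q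
  · obtain ⟨Q, hQM, hQ, ha⟩ := hacc
    exact ⟨Q, hQM.trans (hMP.trans Set.sdiff_subset), hQ, .inl ha⟩
  let Rej : Set ℕ → Prop := fun s => ∀ Q ⊆ M, Q.Infinite → ¬ Accepts U s Q
  have hRej₀ : Rej s₀ := fun Q hQM hQ ha => hacc ⟨Q, hQM, hQ, ha⟩
  have hdec : ∀ k ∈ M, ∀ s ⊆ Set.Iic k, ¬ Rej s → Accepts U s (M \ Set.Iic k) := by
    intro k hk s hs hr
    refine (hMD k hk s hs).1.resolve_right fun h => hr fun Q hQM hQ ha => ?_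
    exact h (Q \ Set.Iic k) (Set.sdiff_subset_sdiff_left hQM) (hQ.sdiff (Set.finite_Iic k))
      (ha.mono Set.sdiff_subset)
  have hD₂ : ∀ k s, s ⊆ Set.Iic k → DenseHereditary fun Q =>
      Rej s → ∀ m ∈ Q, m ∈ M → k < m → Rej (insert m s) := by
    refine fun k s hs => ⟨fun Q Q' h hQ hr m hm => hQ hr m (h hm), fun R hR => ?_⟩
    by_cases hr : Rej s
    swap
    · exact ⟨R, subset_rfl, hR, fun h => absurd h hr⟩
    -- If there were infinitely many such m, they would form a set accepting `s`: split any infinite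
    -- subset at its minimum.
    have hS : {m | m ∈ R ∧ m ∈ M ∧ k < m ∧ ¬ Rej (insert m s)}.Finite := by
      by_contra hS
      refine hr _ (fun m hm => hm.2.1) hS fun A hA hAinf => ?_
      have hmA : sInf A ∈ A := Nat.sInf_mem hAinf.nonempty
      obtain ⟨-, hmM, hkm, hmr⟩ := hA hmA
      have := hdec _ hmM _ (Set.insert_subset (Set.mem_Iic.2 le_rfl)
        (hs.trans (Set.Iic_subset_Iic.2 hkm.le))) hmr (A \ {sInf A}) (fun a ha =>
          ⟨(hA ha.1).2.1, fun h => ha.2 (le_antisymm h (Nat.sInf_le ha.1))⟩)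
        (hAinf.sdiff (Set.finite_singleton _))
      rwa [Set.insert_union, ← Set.union_insert, Set.insert_sdiff_singleton,
        Set.insert_eq_of_mem hmA] at this
    exact ⟨_, Set.sdiff_subset, hR.sdiff hS, fun _ m hm hmM hkm =>
      by_contra fun h => hm.2 ⟨hm.1, hmM, hkm, h⟩⟩
  obtain ⟨N, hNM, hN, hND⟩ := DenseHereditary.fusion (D := fun k Q => ∀ s ∈ 𝒫 (Set.Iic k),
      Rej s → ∀ m ∈ Q, m ∈ M → k < m → Rej (insert m s))
    (fun k => .forall_mem (hfin k) fun s hs => hD₂ k s hs) hM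
  obtain ⟨k₁, hk₁⟩ := hN.nonempty
  refine ⟨N \ Set.Iic k₁, Set.sdiff_subset.trans (hNM.trans (hMP.trans Set.sdiff_subset)),
    hN.sdiff (Set.finite_Iic k₁), .inr fun A hA hAinf hAU => ?_⟩
  have hk₀₁ : k₀ < k₁ := not_le.1 (hMP (hNM hk₁)).2
  -- Rejection spreads from `s₀` to every initial piece of `s₀ ∪ A`. The bound k is kept in `N`
  -- because `hND` applies only there.
  have key : ∀ j, k₁ ≤ j → Rej (s₀ ∪ A ∩ Set.Iic j) ∧
      ∃ k ∈ N, k ≤ j ∧ s₀ ∪ A ∩ Set.Iic j ⊆ Set.Iic k := by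
    intro j hj
    induction j, hj using Nat.le_induction with
    | base =>
      have : A ∩ Set.Iic k₁ = ∅ := Set.eq_empty_of_forall_notMem fun a ha => (hA ha.1).2 ha.2
      rw [this, Set.union_empty]
      exact ⟨hRej₀, k₁, hk₁, le_rfl, fun a ha => (hk₀ ha).trans hk₀₁.le⟩
    | succ j hj ih =>
      obtain ⟨hr, k, hk, hkj, hsk⟩ := ih
      by_cases hjA : j + 1 ∈ A
      · have e : A ∩ Set.Iic (j + 1) = insert (j + 1) (A ∩ Set.Iic j) := by
          ext a
          simp only [Set.mem_inter_iff, Set.mem_Iic, Set.mem_insert_iff]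
          constructor
          · rintro ⟨h1, h2⟩
            rcases h2.lt_or_eq with h | h
            · exact .inr ⟨h1, by omega⟩
            · exact .inl h
          · rintro (rfl | ⟨h1, h2⟩)
            · exact ⟨hjA, le_rfl⟩
            · exact ⟨h1, by omega⟩
        rw [e, Set.union_insert]
        have hjN := (hA hjA).1
        refine ⟨hND k hk _ hsk hr (j + 1) ⟨hjN, by simpa using hkj⟩ (hNM hjN) (by omega),
          j + 1, hjN, le_rfl, Set.insert_subset (Set.mem_Iic.2 le_rfl) (hsk.trans ?_)⟩
        exact Set.Iic_subset_Iic.2 (by omega)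
      · have e : A ∩ Set.Iic (j + 1) = A ∩ Set.Iic j := by
          ext a
          simp only [Set.mem_inter_iff, Set.mem_Iic]
          refine ⟨fun ⟨h1, h2⟩ => ⟨h1, ?_⟩, fun ⟨h1, h2⟩ => ⟨h1, by omega⟩⟩
          rcases h2.lt_or_eq with h | h
          · omega
          · exact absurd (h ▸ h1) hjA
        rw [e]
        exact ⟨hr, k, hk, by omega, hsk⟩
  obtain ⟨n, hn⟩ := Set.mem_iUnion.1 hAU
  obtain ⟨k, hkA, hnk⟩ := hAinf.exists_gt n
  have hk₁k : k₁ < k := not_le.1 (hA hkA).2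
  have hkM := hNM (hA hkA).1
  have hsub : s₀ ∪ A ∩ Set.Iic k ⊆ Set.Iic k :=
    Set.union_subset (fun a ha => (hk₀ ha).trans (hk₀₁.trans hk₁k).le) Set.inter_subset_right
  -- `V n` is decided beyond k: acceptance contradicts the rejection of the initial piece, and the
  -- alternative contradicts `s₀ ∪ A ∈ V n`.
  rcases (hMD k hkM _ hsub).2 n hnk.le with h | h
  · exact (key k hk₁k.le).1 (M \ Set.Iic k) Set.sdiff_subset (hM.sdiff (Set.finite_Iic k))
      fun B hB hBinf => Set.mem_iUnion.2 ⟨n, h B hB hBinf⟩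
  · refine h (A \ Set.Iic k) (fun a ha => ⟨hNM (hA ha.1).1, ha.2⟩)
      (hAinf.sdiff (Set.finite_Iic k)) ?_
    rwa [Set.union_assoc, Set.inter_union_sdiff]

/-- The `σ`-algebra of completely Ramsey families. -/
@[reducible] def ramseySpace : MeasurableSpace (Set ℕ) where
  MeasurableSet' := CompletelyRamsey
  measurableSet_empty := .of_exists fun _ _ P hP =>
    ⟨P, subset_rfl, hP, .inr fun _ _ _ => by simp⟩
  measurableSet_compl _ := CompletelyRamsey.compl
  measurableSet_iUnion _ := CompletelyRamsey.iUnion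

theorem completelyRamsey_setOf_mem (n : ℕ) : CompletelyRamsey {A | n ∈ A} := by
  refine .of_exists fun s _ P hP =>
    ⟨P \ {n}, Set.sdiff_subset, hP.sdiff (Set.finite_singleton n), ?_⟩
  by_cases h : n ∈ s
  · exact .inl fun A _ _ => .inl h
  · exact .inr fun A hA _ hn => hn.elim h fun hn => (hA hn).2 rfl

open Classical in
/-- Borel families of sets are completely Ramsey. -/
theorem completelyRamsey_of_measurableSet {W : Set (ℕ → Bool)} (hW : MeasurableSet W) :
    CompletelyRamsey {A : Set ℕ | (fun n => decide (n ∈ A)) ∈ W} := by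
  let _ := ramseySpace
  have h : Measurable fun (A : Set ℕ) (n : ℕ) => decide (n ∈ A) := by
    refine measurable_pi_iff.2 fun n => measurable_to_bool ?_
    have : (fun A : Set ℕ => decide (n ∈ A)) ⁻¹' {true} = {A | n ∈ A} := by ext; simp
    rw [this]
    exact completelyRamsey_setOf_mem n
  exact h hW

/-! ### Pseudointersections and G_δ-sets in `[ω]^ω`. -/

/-- A family of fewer than `𝔭` subsets of a countably infinite set all of whose finite
intersections are infinite has an infinite pseudointersection. -/
theorem exists_infinite_pseudointersection {T ι : Type} [Countable T] [Infinite T]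
    (hι : #ι < pseudointersectionNumber) (B : ι → Set T)
    (hB : ∀ t : Finset ι, (⋂ i ∈ t, B i).Infinite) :
    ∃ S : Set T, S.Infinite ∧ ∀ i, (S \ B i).Finite := by
  obtain ⟨e⟩ : Nonempty (T ≃ ℕ) := nonempty_equiv_of_countable
  have hcard : #(Set.range fun i => e '' B i) < pseudointersectionNumber := mk_range_le.trans_lt hι
  obtain ⟨A, hA, hAB⟩ : ∃ A : Set ℕ, A.Infinite ∧
      ∀ F ∈ Set.range fun i => e '' B i, AlmostSubset A F := by
    by_contra hno
    refine notMem_of_lt_csInf' hcard ⟨_, rfl, ?_, ?_, hno⟩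
    · rintro _ ⟨i, rfl⟩
      simpa using (hB {i}).image e.injective.injOn
    · classical
      rintro 𝓕 h𝓕 hfin ⟨F₀, hF₀⟩
      obtain ⟨i₀, -⟩ := h𝓕 hF₀
      have : Nonempty ι := ⟨i₀⟩
      have hex : ∀ F ∈ 𝓕, ∃ i, e '' B i = F := fun F hF => h𝓕 hF
      choose! g hg using hex
      refine ((hB (hfin.toFinset.image g)).image e.injective.injOn).mono ?_
      rintro _ ⟨x, hx, rfl⟩ F hF
      rw [← hg F hF]
      refine ⟨x, ?_, rfl⟩
      simp only [Set.mem_iInter] at hx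
      exact hx (g F) (Finset.mem_image_of_mem g (hfin.mem_toFinset.2 hF))
  refine ⟨e ⁻¹' A, hA.preimage (by simp), fun i => ?_⟩
  have h := (hAB _ ⟨i, rfl⟩).preimage e.injective.injOn
  rwa [Set.preimage_sdiff, e.preimage_image] at h

namespace InfiniteSubsets

theorem continuous_charFun : Continuous charFun := continuous_induced_dom

theorem charFun_injective : Function.Injective charFun := fun A B h => Subtype.ext <| by
  ext n
  simpa [charFun] using congrFun h n

theorem isEmbedding_charFun : Topology.IsEmbedding charFun :=
  ⟨⟨rfl⟩, charFun_injective⟩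

/-- Only finitely many coordinates matter, and a finite power of `Bool` is discrete. -/
theorem isOpen_setOf_inter_Iic (p : Set ℕ → Prop) (k : ℕ) :
    IsOpen {A : InfiniteSubsets | p (A.1 ∩ Set.Iic k)} := by
  let r : InfiniteSubsets → Set.Iic k → Bool := fun A i => A.charFun i
  have hr : Continuous r :=
    continuous_pi fun i => (continuous_apply (i : ℕ)).comp continuous_charFun
  have h : {A : InfiniteSubsets | p (A.1 ∩ Set.Iic k)} =
      r ⁻¹' {b | p {n | ∃ h : n ≤ k, b ⟨n, h⟩ = true}} := by
    ext A
    have : A.1 ∩ Set.Iic k = {n | ∃ h : n ≤ k, r A ⟨n, h⟩ = true} := by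
      ext n
      simp [r, charFun, and_comm]
    simp [this]
  rw [h]
  exact (isOpen_discrete _).preimage hr

theorem isOpen_setOf_mem (n : ℕ) : IsOpen {A : InfiniteSubsets | n ∈ A.1} := by
  simpa using isOpen_setOf_inter_Iic (n ∈ ·) n

end InfiniteSubsets

theorem isGδ_setOf_infinite {X T : Type*} [TopologicalSpace X] [Countable T] {U : T → Set X}
    (hU : ∀ t, IsOpen (U t)) : IsGδ {x | {t | x ∈ U t}.Infinite} := by
  have h : {x | {t | x ∈ U t}.Infinite} = ⋂ s : Finset T, ⋃ t ∈ {t | t ∉ s}, U t := by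
    ext x
    simp only [Set.mem_ofPred_eq, Set.mem_iInter, Set.mem_iUnion, exists_prop]
    refine ⟨fun hx s => ?_, fun hx hfin => ?_⟩
    · obtain ⟨t, ht, hts⟩ := hx.exists_notMem_finset s
      exact ⟨t, hts, ht⟩
    · obtain ⟨t, hts, ht⟩ := hx hfin.toFinset
      exact hts (hfin.mem_toFinset.2 ht)
  rw [h]
  exact .iInter_of_isOpen fun s => isOpen_biUnion fun t _ => hU t

open InfiniteSubsets

theorem isGδ_setOf_not_almostSubset (N : Set ℕ) :
    IsGδ {A : InfiniteSubsets | ¬ AlmostSubset A.1 N} := by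
  have := isGδ_setOf_infinite (X := InfiniteSubsets) (U := fun n : ℕ => {A | n ∈ A.1 ∧ n ∉ N})
    fun n => (isOpen_setOf_mem n).inter isOpen_const
  exact this

/-- A subspace of `[ω]^ω` with fewer than `𝔭` points is a `Q`-set. -/
theorem exists_isGδ_forall_mem_iff {ι : Type} (hι : #ι < pseudointersectionNumber)
    (f : ι → InfiniteSubsets) (Y : Set InfiniteSubsets) :
    ∃ H : Set InfiniteSubsets, IsGδ H ∧ ∀ i, f i ∈ H ↔ f i ∈ Y := by
  classical
  let r : ℕ → InfiniteSubsets → Finset ℕ := fun n A => (Finset.Iic n).filter (· ∈ A.1)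
  -- Countably many clopen sets. Any finitely many `f i` are classified correctly by infinitely many
  -- of them, so a pseudointersection `S` classifies each `f i` correctly with finitely many
  -- exceptions.
  let C : ℕ × Finset (Finset ℕ) → Set InfiniteSubsets := fun t => {A | r t.1 A ∈ t.2}
  have hC : ∀ t, IsOpen (C t) := fun t => by
    convert! isOpen_setOf_inter_Iic (fun s => (Finset.Iic t.1).filter (· ∈ s) ∈ t.2) t.1 using 2
    ext A
    have : r t.1 A = (Finset.Iic t.1).filter (· ∈ A.1 ∩ Set.Iic t.1) := by
      ext n
      simp +contextual [r]
    simp only [this]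
    congr!
  obtain ⟨S, hS, hSf⟩ := exists_infinite_pseudointersection hι
    (fun i => {t | f i ∈ C t ↔ f i ∈ Y}) fun t => by
      have hev : ∀ᶠ n in Filter.atTop, ∀ i ∈ t, ∀ j ∈ t, r n (f i) = r n (f j) → f i = f j := by
        simp only [Filter.eventually_all_finset]
        intro i _ j _
        by_cases hij : f i = f j
        · exact .of_forall fun _ _ => hij
        · obtain ⟨m, hm⟩ : ∃ m, ¬ (m ∈ (f i).1 ↔ m ∈ (f j).1) := by
            by_contra! h
            exact hij (Subtype.ext (Set.ext h))
          filter_upwards [Filter.eventually_ge_atTop m] with n hn h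
          refine absurd ?_ hm
          simpa [r, hn] using Finset.ext_iff.1 h m
      obtain ⟨n₀, hn₀⟩ := Filter.eventually_atTop.1 hev
      let c : ℕ → ℕ × Finset (Finset ℕ) := fun n =>
        (n, (t.filter (f · ∈ Y)).image fun i => r n (f i))
      have hc : Function.Injective c := fun a b h => congrArg Prod.fst h
      refine ((Set.Ici_infinite n₀).image hc.injOn).mono ?_
      rintro _ ⟨n, hn, rfl⟩
      simp only [Set.mem_iInter]
      intro i hi
      simp only [Set.mem_ofPred_eq, C, c, Finset.mem_image, Finset.mem_filter]
      constructor
      · rintro ⟨j, ⟨hj, hjY⟩, h⟩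
        rwa [hn₀ n hn j hj i hi h] at hjY
      · exact fun h => ⟨i, ⟨hi, h⟩, rfl⟩
  refine ⟨_, isGδ_setOf_infinite (U := fun t => {A | t ∈ S ∧ A ∈ C t}) fun t =>
    isOpen_const.inter (hC t), fun i => ?_⟩
  by_cases hi : f i ∈ Y
  · simp only [hi, iff_true]
    refine (hS.sdiff (hSf i)).mono fun t ht => ⟨ht.1, ?_⟩
    by_contra h
    exact ht.2 ⟨ht.1, fun h' => h (h'.2 hi)⟩
  · simp only [hi, iff_false]
    refine Set.not_infinite.2 ((hSf i).subset fun t ht => ⟨ht.1, ?_⟩)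
    simpa [hi] using ht.2

/-- Fewer than `𝔭` infinite sets all meet almost all members of some infinite family of intervals
tending to infinity. -/
theorem exists_infinite_set_intervals {ι : Type} (hι : #ι < pseudointersectionNumber)
    (hω : ℵ₀ < pseudointersectionNumber) (f : ι → InfiniteSubsets) :
    ∃ S : Set (ℕ × ℕ), S.Infinite ∧ (∀ i, {t ∈ S | ∀ m ∈ (f i).1, t.1 ≤ m → t.2 ≤ m}.Finite) ∧
      ∀ k, {t ∈ S | t.1 ≤ k}.Finite := by
  have hcard : #(ι ⊕ ℕ) < pseudointersectionNumber := by
    rw [mk_sum, lift_id, lift_id, mk_nat]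
    exact add_lt_of_lt hω.le hι hω
  -- A pair codes the interval [t.1, t.2). The constraints indexed by ℕ push the intervals to
  -- infinity.
  obtain ⟨S, hS, hSf⟩ := exists_infinite_pseudointersection (T := ℕ × ℕ) hcard
    (Sum.elim (fun i => {t | ∃ m ∈ (f i).1, t.1 ≤ m ∧ m < t.2}) fun k => {t | k < t.1})
    fun t => by
      have h₁ : ∀ a : ℕ, ∀ᶠ b in Filter.atTop, ∀ x ∈ t, ∀ i, x = .inl i →
          ∃ m ∈ (f i).1, a ≤ m ∧ m < b := fun a => by
        simp only [Filter.eventually_all_finset]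
        rintro (i | k) _
        · obtain ⟨m, hm, ham⟩ := (f i).2.exists_gt a
          filter_upwards [Filter.eventually_gt_atTop m] with b hb j hj
          cases hj
          exact ⟨m, hm, ham.le, hb⟩
        · simp
      choose b hb using fun a => (h₁ a).exists
      have h₂ : ∀ᶠ a in Filter.atTop, ∀ x ∈ t, ∀ k, x = .inr k → k < a := by
        simp only [Filter.eventually_all_finset]
        rintro (i | k) _
        · simp
        · filter_upwards [Filter.eventually_gt_atTop k] with a ha j hj
          cases hj
          exact ha
      obtain ⟨a₀, ha₀⟩ := Filter.eventually_atTop.1 h₂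
      have hc : Function.Injective fun a => (a, b a) := fun a b h => congrArg Prod.fst h
      refine ((Set.Ici_infinite a₀).image hc.injOn).mono ?_
      rintro _ ⟨a, ha, rfl⟩
      simp only [Set.mem_iInter]
      rintro (i | k) hx
      · exact hb a _ hx i rfl
      · exact ha₀ a ha _ hx k rfl
  refine ⟨S, hS, fun i => (hSf (.inl i)).subset ?_, fun k => (hSf (.inr k)).subset ?_⟩
  · rintro t ⟨ht, h⟩
    refine ⟨ht, ?_⟩
    rintro ⟨m, hm, h1, h2⟩
    exact (h m hm h1).not_gt h2
  · rintro t ⟨ht, h⟩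
    exact ⟨ht, fun h' => h.not_gt h'⟩

/-- Towers of length less than `𝔭` have infinite pseudointersections. -/
theorem exists_pseudointersection_tower {ι : Type} [LinearOrder ι]
    (hι : #ι < pseudointersectionNumber) (f : ι → InfiniteSubsets)
    (hf : ∀ β α, β < α → AlmostSubset (f α).1 (f β).1) :
    ∃ P : Set ℕ, P.Infinite ∧ ∀ i, AlmostSubset P (f i).1 := by
  refine exists_infinite_pseudointersection hι (fun i => (f i).1) fun t => ?_
  rcases t.eq_empty_or_nonempty with rfl | ht
  · simpa using Set.infinite_univ
  intro hfin
  -- The last of finitely many members is almost contained in their intersection.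
  refine (f (t.max' ht)).2 ((hfin.union (t.finite_toSet.biUnion fun i hi => ?_)).subset
    (?_ : _ ⊆ _ ∪ ⋃ i ∈ (t : Set ι), (f (t.max' ht)).1 \ (f i).1))
  · rcases (t.le_max' i hi).eq_or_lt with h | h
    · rw [← h]; simp
    · exact hf _ _ h
  · intro m hm
    by_cases h : ∀ i ∈ t, m ∈ (f i).1
    · exact .inl (by simpa using h)
    · push Not at h
      obtain ⟨i, hi, hmi⟩ := h
      exact .inr (Set.mem_biUnion hi ⟨hm, hmi⟩)

/-! ### Extending the tower. -/

/-- The successor step of the tower: an almost lower bound `N` of `f` such that a given Borel set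
has a relatively `G_δ` trace on the almost subsets of `N`, and these can be separated from `f` by a
`G_δ`-set. -/
theorem exists_tower_extension {ι : Type} [LinearOrder ι]
    (hι : #ι < pseudointersectionNumber) (hω : ℵ₀ < pseudointersectionNumber)
    (f : ι → InfiniteSubsets) (hf : ∀ β α, β < α → AlmostSubset (f α).1 (f β).1)
    {W : Set (ℕ → Bool)} (hW : MeasurableSet W) :
    ∃ N : InfiniteSubsets, (∀ β, StrictAlmostSubset N.1 (f β).1) ∧
      (∃ H : Set InfiniteSubsets, IsGδ H ∧ (∀ β, f β ∉ H) ∧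
        ∀ A : InfiniteSubsets, AlmostSubset A.1 N.1 → A ∈ H) ∧
      ∃ G : Set InfiniteSubsets, IsGδ G ∧
        ∀ A : InfiniteSubsets, AlmostSubset A.1 N.1 → (A ∈ G ↔ A.charFun ∈ W) := by
  classical
  obtain ⟨P, hP, hPf⟩ := exists_pseudointersection_tower hι f hf
  obtain ⟨S, hS, hSf, hSk⟩ := exists_infinite_set_intervals hι hω f
  set U : Set (Set ℕ) := {A | (fun n => decide (n ∈ A)) ∈ W} with hU
  have hUR : CompletelyRamsey U := completelyRamsey_of_measurableSet hW
  -- Imposed after every k in `N`, this makes `N` jump over infinitely many intervals of `S`.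
  have hDS : ∀ k, DenseHereditary fun Q => ∃ t ∈ S, k < t.1 ∧ ∀ m ∈ Q, t.2 ≤ m := by
    refine fun k => ⟨fun Q Q' h => ?_, fun R hR => ?_⟩
    · rintro ⟨t, ht, hkt, hQ⟩
      exact ⟨t, ht, hkt, fun m hm => hQ m (h hm)⟩
    · obtain ⟨t, ht, hkt⟩ := (hS.sdiff (hSk k)).nonempty
      exact ⟨R \ Set.Iio t.2, Set.sdiff_subset, hR.sdiff (Set.finite_Iio _), t, ht,
        not_le.1 fun h => hkt ⟨ht, h⟩, fun m hm => not_lt.1 hm.2⟩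
  obtain ⟨N, hNP, hN, hND⟩ := DenseHereditary.fusion
    (D := fun k Q => (∃ t ∈ S, k < t.1 ∧ ∀ m ∈ Q, t.2 ≤ m) ∧
      ∀ s ∈ 𝒫 (Set.Iic k), Homogeneous U s Q)
    (fun k => (hDS k).and (.forall_mem (Set.finite_Iic k).finite_subsets fun s hs =>
      hUR s ((Set.finite_Iic k).subset hs))) hP
  have hbound : ∀ A, AlmostSubset A N → ∃ n, ∀ a ∈ A, n < a → a ∈ N := fun A hA => by
    obtain ⟨n, hn⟩ := Set.Finite.bddAbove hA
    exact ⟨n, fun a ha hna => by_contra fun h => hna.not_ge (hn ⟨ha, h⟩)⟩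
  let H : Set InfiniteSubsets := {A | {t | t ∈ S ∧ ∀ m ∈ A.1, t.1 ≤ m → t.2 ≤ m}.Infinite}
  have hH : IsGδ H := by
    refine isGδ_setOf_infinite (U := fun t : ℕ × ℕ =>
      {A : InfiniteSubsets | t ∈ S ∧ ∀ m ∈ A.1, t.1 ≤ m → t.2 ≤ m}) fun t => ?_
    convert! isOpen_setOf_inter_Iic
      (fun s => t ∈ S ∧ ∀ m ∈ s, t.1 ≤ m → t.2 ≤ m) t.2 using 4 with A
    refine ⟨fun h m hm => h m hm.1, fun h m hm htm => ?_⟩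
    by_contra hlt
    exact hlt (h m ⟨hm, (not_le.1 hlt).le⟩ htm)
  have hfH : ∀ β, f β ∉ H := fun β => Set.not_infinite.2 (hSf β)
  have hNH : ∀ A : InfiniteSubsets, AlmostSubset A.1 N → A ∈ H := by
    intro A hA hfin
    obtain ⟨n, hn⟩ := hbound _ hA
    obtain ⟨b, hb⟩ := (hfin.image Prod.fst).bddAbove
    obtain ⟨k, hkN, hk⟩ := hN.exists_gt (max n b)
    obtain ⟨t, ht, hkt, htm⟩ := (hND k hkN).1
    have : t.1 ≤ b := hb ⟨t, ⟨ht, fun m hm hm1 => htm m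
      ⟨hn m hm (((le_max_left n b).trans_lt hk).trans (hkt.trans_le hm1)),
        not_le.2 (hkt.trans_le hm1)⟩⟩, rfl⟩
    exact absurd ((le_max_right n b).trans_lt (hk.trans hkt)) this.not_gt
  -- Strictness follows from separation: otherwise `f β` would lie in `H`. In the second G_δ-set,
  -- the escape clause m ∉ N fails for large k when A ⊆* N, leaving acceptance of an initial piece
  -- of A.
  refine ⟨⟨N, hN⟩, fun β => ⟨(hPf β).subset (Set.sdiff_subset_sdiff_left hNP), fun hfin =>
    hfH β (hNH _ hfin)⟩, ⟨H, hH, hfH, hNH⟩, ⋂ k ∈ N, {A | (∃ m, m ∈ A.1 ∧ k < m ∧ m ∉ N) ∨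
      Accepts U (A.1 ∩ Set.Iic k) (N \ Set.Iic k)}, ?_, fun A hA => ?_⟩
  · refine .biInter N.to_countable fun k _ => IsOpen.isGδ (.union ?_ ?_)
    · have : {A : InfiniteSubsets | ∃ m, m ∈ A.1 ∧ k < m ∧ m ∉ N} =
          ⋃ m ∈ {m | k < m ∧ m ∉ N}, {A | m ∈ A.1} := by
        ext A
        simp [and_comm, and_assoc]
      change IsOpen {A : InfiniteSubsets | ∃ m, m ∈ A.1 ∧ k < m ∧ m ∉ N}
      rw [this]
      exact isOpen_biUnion fun m _ => isOpen_setOf_mem m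
    · exact isOpen_setOf_inter_Iic (fun s => Accepts U s (N \ Set.Iic k)) k
  · have hAU : A.charFun ∈ W ↔ A.1 ∈ U := Iff.rfl
    rw [hAU]
    simp only [Set.mem_iInter]
    constructor
    · intro h
      obtain ⟨n, hn⟩ := hbound _ hA
      obtain ⟨k, hkN, hk⟩ := hN.exists_gt n
      rcases h k hkN with ⟨m, hmA, hkm, hmN⟩ | h
      · exact absurd (hn m hmA (hk.trans hkm)) hmN
      · have := h (A.1 \ Set.Iic k) (fun a ha => ⟨hn a ha.1 (hk.trans (not_le.1 ha.2)), ha.2⟩)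
          (A.2.sdiff (Set.finite_Iic k))
        rwa [Set.inter_union_sdiff] at this
    · intro h k hkN
      by_cases hm : ∃ m, m ∈ A.1 ∧ k < m ∧ m ∉ N
      · exact .inl hm
      · push Not at hm
        refine .inr (((hND k hkN).2 _ Set.inter_subset_right).resolve_right fun hc => ?_)
        have := hc (A.1 \ Set.Iic k) (fun a ha => ⟨hm a ha.1 (not_le.1 ha.2), ha.2⟩)
          (A.2.sdiff (Set.finite_Iic k))
        rw [Set.inter_union_sdiff] at this
        exact this h

/-! ### Counting Borel sets, and assembling the tower. -/

theorem mk_setOf_measurableSet_le_continuum (α : Type) [MeasurableSpace α]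
    [h : MeasurableSpace.CountablyGenerated α] : #{s : Set α | MeasurableSet s} ≤ 𝔠 := by
  obtain ⟨b, hb, rfl⟩ := h.isCountablyGenerated
  exact MeasurableSpace.cardinal_measurableSet_le_continuum
    (hb.le_aleph0.trans aleph0_le_continuum)

theorem not_isQSet_of_mk_eq_continuum {X : Type} [TopologicalSpace X]
    [SecondCountableTopology X] (hX : #X = 𝔠) : ¬ IsQSet X := by
  rintro ⟨-, -, hQ⟩
  borelize X
  have h := mk_setOf_measurableSet_le_continuum X
  have : {s : Set X | MeasurableSet s} = Set.univ :=
    Set.eq_univ_of_forall fun s => (hQ s).measurableSet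
  rw [this, mk_univ, mk_set, hX] at h
  exact h.not_gt (cantor 𝔠)

instance : SecondCountableTopology InfiniteSubsets := isEmbedding_charFun.secondCountableTopology

instance : TopologicalSpace.MetrizableSpace InfiniteSubsets := isEmbedding_charFun.metrizableSpace

/-- A well-ordered strict tower with `G_δ` traces of all Borel sets and separated tails is a
`σ`-set. -/
theorem isSigmaSet_range_tower {κ : Type} [LinearOrder κ]
    (hκ : ∀ α : κ, #(Set.Iio α) < pseudointersectionNumber) (M : κ → InfiniteSubsets)
    (hM : ∀ β α, β < α → StrictAlmostSubset (M α).1 (M β).1)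
    (hH : ∀ α, ∃ H : Set InfiniteSubsets, IsGδ H ∧ (∀ β < α, M β ∉ H) ∧
      ∀ A : InfiniteSubsets, AlmostSubset A.1 (M α).1 → A ∈ H)
    (hG : ∀ W : Set (ℕ → Bool), MeasurableSet W → ∃ α, ∃ G : Set InfiniteSubsets, IsGδ G ∧
      ∀ A : InfiniteSubsets, AlmostSubset A.1 (M α).1 → (A ∈ G ↔ A.charFun ∈ W)) :
    IsSigmaSet (Set.range M) := by
  refine ⟨inferInstance, inferInstance, ?_⟩
  rintro F ⟨C, hC, rfl⟩
  have hC' : ∀ n, ∃ D : Set (ℕ → Bool), IsClosed D ∧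
      (fun x : Set.range M => x.1.charFun) ⁻¹' D = C n := fun n =>
    ((isEmbedding_charFun.comp .subtypeVal).isInducing.isClosed_iff).1 (hC n)
  choose D hD hDC using hC'
  obtain ⟨α, G, hGδ, hGW⟩ := hG (⋃ n, D n) (.iUnion fun n => (hD n).measurableSet)
  obtain ⟨H, hHδ, hHlt, hHge⟩ := hH α
  obtain ⟨K, hKδ, hK⟩ := exists_isGδ_forall_mem_iff (hκ α) (fun β => M β)
    {A | A.charFun ∈ ⋃ n, D n}
  -- `H ∩ G` handles the indices from α on; the other term handles those below α.
  have key : (⋃ n, C n) = Subtype.val ⁻¹'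
      (H ∩ G ∪ {A | ¬ AlmostSubset A.1 (M α).1} ∩ K) := by
    ext ⟨_, γ, rfl⟩
    have hmem : (⟨M γ, γ, rfl⟩ : Set.range M) ∈ (⋃ n, C n) ↔ (M γ).charFun ∈ ⋃ n, D n := by
      simp [← hDC]
    rw [hmem]
    rcases lt_or_ge γ α with h | h
    · have h1 : ¬ AlmostSubset (M γ).1 (M α).1 := (hM γ α h).2
      have h2 := hK ⟨γ, h⟩
      have h3 := hHlt γ h
      simp only [Set.mem_preimage, Set.mem_union, Set.mem_inter_iff, h3, false_and, false_or]
      exact ⟨fun hx => ⟨h1, h2.2 hx⟩, fun hx => h2.1 hx.2⟩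
    · have h1 : AlmostSubset (M γ).1 (M α).1 := by
        rcases h.eq_or_lt with rfl | h
        · simp [AlmostSubset]
        · exact (hM α γ h).1
      exact ⟨fun hx => .inl ⟨hHge _ h1, (hGW _ h1).2 hx⟩, fun hx => hx.elim
        (fun hx => (hGW _ h1).1 hx.2) fun hx => absurd h1 hx.1⟩
  rw [key]
  exact ((hHδ.inter hGδ).union ((isGδ_setOf_not_almostSubset _).inter hKδ)).preimage
    continuous_subtype_val

/-- Recursive construction of the tower. -/
theorem exists_tower {κ : Type} [LinearOrder κ] [WellFoundedLT κ]
    (hω : ℵ₀ < pseudointersectionNumber)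
    (hκ : ∀ α : κ, #(Set.Iio α) < pseudointersectionNumber)
    (W : κ → Set (ℕ → Bool)) (hW : ∀ α, MeasurableSet (W α)) :
    ∃ M : κ → InfiniteSubsets, (∀ β α, β < α → StrictAlmostSubset (M α).1 (M β).1) ∧
      (∀ α, ∃ H : Set InfiniteSubsets, IsGδ H ∧ (∀ β < α, M β ∉ H) ∧
        ∀ A : InfiniteSubsets, AlmostSubset A.1 (M α).1 → A ∈ H) ∧
      ∀ α, ∃ G : Set InfiniteSubsets, IsGδ G ∧
        ∀ A : InfiniteSubsets, AlmostSubset A.1 (M α).1 → (A ∈ G ↔ A.charFun ∈ W α) := by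
  have : Nonempty InfiniteSubsets := ⟨⟨Set.univ, Set.infinite_univ⟩⟩
  have step := fun (α : κ) (f : Set.Iio α → InfiniteSubsets) =>
    exists_tower_extension (hκ α) hω f (hW := hW α)
  -- Here `g` is total, so the recursion runs first and the tower property it needs is proved
  -- afterwards by induction.
  choose! g hg using step
  let M : κ → InfiniteSubsets := WellFoundedLT.fix fun α f => g α fun β => f β.1 β.2
  have hMg : ∀ α, M α = g α fun β => M β := fun α => WellFoundedLT.fix_eq _ α
  have hM : ∀ α, ∀ β < α, StrictAlmostSubset (M α).1 (M β).1 := by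
    intro α
    induction α using WellFoundedLT.induction with
    | ind α ih =>
      intro β hβ
      rw [hMg α]
      exact (hg α (fun β => M β) fun β γ h => (ih γ γ.2 β h).1).1 ⟨β, hβ⟩
  have hspec := fun α => (hg α (fun β => M β) fun β γ h => (hM γ β h).1).2
  simp only [← hMg] at hspec
  refine ⟨M, fun β α => hM α β, fun α => ?_, fun α => (hspec α).2⟩
  obtain ⟨H, h1, h2, h3⟩ := (hspec α).1
  exact ⟨H, h1, fun β hβ => h2 ⟨β, hβ⟩, h3⟩

theorem mainTheorem12 (hpc : pseudointersectionNumber = 𝔠) :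
    ∃ X : Set InfiniteSubsets,
      IsSigmaSet X ∧ #X = 𝔠 ∧ ¬ IsQSet X ∧
      ∃ M : Set.Iio (𝔠 : Cardinal.{0}).ord → InfiniteSubsets,
        X = Set.range M ∧
        ∀ β α : Set.Iio (𝔠 : Cardinal.{0}).ord, β < α → StrictAlmostSubset (M α).1 (M β).1 := by
  let κ : Type := (𝔠 : Cardinal.{0}).ord.ToType
  have hκ : ∀ α : κ, #(Set.Iio α) < pseudointersectionNumber := fun α => by
    have := mk_Iio_lt α (by simp [κ])
    rw [hpc]
    simpa [κ] using this
  have hω : ℵ₀ < pseudointersectionNumber := hpc ▸ aleph0_lt_continuum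
  obtain ⟨W, hW⟩ : ∃ W : κ → {s : Set (ℕ → Bool) | MeasurableSet s}, Function.Surjective W := by
    have : Nonempty {s : Set (ℕ → Bool) | MeasurableSet s} := ⟨⟨∅, by simp⟩⟩
    have hle : #{s : Set (ℕ → Bool) | MeasurableSet s} ≤ #κ :=
      (mk_setOf_measurableSet_le_continuum _).trans_eq (mk_ord_toType _).symm
    obtain ⟨e⟩ := hle
    exact ⟨_, Function.invFun_surjective e.injective⟩
  obtain ⟨M, hM, hH, hG⟩ := exists_tower hω hκ (fun α => (W α).1) fun α => (W α).2
  have hinj : Function.Injective M := by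
    intro β α e
    have hne : ∀ β α, M β = M α → ¬ β < α := fun β α e h =>
      (hM β α h).2 (by rw [e]; simp)
    exact le_antisymm (not_lt.1 (hne α β e.symm)) (not_lt.1 (hne β α e))
  have hcard : #(Set.range M) = 𝔠 := (mk_range_eq M hinj).trans (mk_ord_toType _)
  refine ⟨Set.range M, isSigmaSet_range_tower hκ M hM hH fun V hV => ?_, hcard,
    not_isQSet_of_mk_eq_continuum hcard, fun α => M (Ordinal.ToType.mk α),
    (Ordinal.ToType.mk.surjective.range_comp M).symm, fun β α h =>
      hM _ _ (Ordinal.ToType.mk.lt_iff_lt.2 h)⟩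
  obtain ⟨α, hα⟩ := hW ⟨V, hV⟩
  refine ⟨α, ?_⟩
  simpa only [hα] using hG α
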